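/- Let \(D\) be a division ring with infinite center \(F\), and let \(n\ge 1\) be an integer. Assume that one of the following conditions holds: (i) \(D\) is of characteristic zero and algebraic over \(F\), i.e. every element of \(D\) is a root of a nonzero polynomial with coefficients in \(F\); (ii) \(D\) is finite-dimensional over \(F\), \(\operatorname{char}(F)=p>0\), and \(p\) divides neither \(\sqrt{\dim_F D}\) nor \(n\). Let \(F\langle\mathcal X\rangle\) be the free unital associative \(F\)-algebra on \(\mathcal X=\{x_1,x_2,\dots\}\). For \(f=f(x_1,\dots,x_m)\in F\langle\mathcal X\rangle\) and a unital associative \(F\)-algebra \(A\) with center \(Z(A)\), put \(f(A)=\{f(a_1,\dots,a_m): a_1,\dots,a_m\in A\}\). Call \(f\) a polynomial identity of \(A\) if \(f(A)=\{0\}\) (this includes \(f=0\)), and a central polynomial of \(A\) if \(f(A)\subseteq Z(A)\) but \(f(A)\ne\{0\}\). If \(f\in F\langle\mathcal X\rangle\) is neither a polynomial identity nor a central polynomial of the matrix algebra \(\mathrm M_n(D)\), then \[ \mathrm M_n(D)=Z(\mathrm M_n(D))+\operatorname{span} f(\mathrm M_n(D)), \] where \(\operatorname{span}\) denotes the \(F\)-linear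 span. -/

import Mathlib

namespace NCPoly

/-- The free unital associative `F`-algebra `F⟨X⟩` on countably many noncommuting variables. -/
abbrev FreeAlg (F : Type*) [CommRing F] : Type _ := FreeAlgebra F ℕ

/-- The image `f(A)` of a noncommutative polynomial `f` on an `F`-algebra `A`: the set of all
values of `f` under substitutions of elements of `A` for the variables.  Only the finitely many
variables that occur in `f` matter. -/
def image {F : Type*} [CommRing F] (f : FreeAlg F) (A : Type*) [Ring A] [Algebra F A] : Set A :=
  Set.range fun a : ℕ → A => FreeAlgebra.lift F a f

/-- `f` is a polynomial identity of `A`: it takes only the value `0` on `A`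
(the zero polynomial is included). -/
def IsPolynomialIdentity {F : Type*} [CommRing F] (f : FreeAlg F)
    (A : Type*) [Ring A] [Algebra F A] : Prop :=
  image f A = {0}

/-- `f` is a central polynomial of `A`: all its values on `A` are central in `A`, but `f` does
not vanish identically on `A`. -/
def IsCentralPolynomial {F : Type*} [CommRing F] (f : FreeAlg F)
    (A : Type*) [Ring A] [Algebra F A] : Prop :=
  image f A ⊆ Set.center A ∧ image f A ≠ {0}

/-- The condition on a division ring `D` with center `F` and on `n`: either `D` is algebraic over
`F` and of characteristic zero, or `D` is finite-dimensional over `F`, the characteristic `p` of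
`F` is positive, and `p` divides neither `√(dim_F D)` nor `n`.  (The dimension of a division ring
over its center, when finite, is a perfect square, so that `Nat.sqrt` is its exact square root.) -/
def Admissible (D : Type*) [DivisionRing D] (n : ℕ) : Prop :=
  (Algebra.IsAlgebraic (Subring.center D) D ∧ CharZero D) ∨
  (FiniteDimensional (Subring.center D) D ∧
    ∃ p : ℕ, 0 < p ∧ CharP (Subring.center D) p ∧
      ¬ p ∣ Nat.sqrt (Module.finrank (Subring.center D) D) ∧ ¬ p ∣ n)

end NCPoly

/-! Let `A` be the matrix algebra and `L` the span of the values of `f`. As `F` is infinite, the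
part linear in `t` of `f(a + t[a, x])`, namely `[f(a), x]`, lies in `L`: `L` is a Lie ideal
(`isLieIdeal_span_image`). By Herstein's argument a noncentral Lie ideal of the simple ring `A`
contains `[A, A]` (`IsLieIdeal.lieTransporter_eq_top_of_not_central`); characteristic 2 is delicate,
but there the hypotheses make the dimension odd.

It remains to see that a functional `φ` killing commutators and `1` is zero. This passes from `D` to
matrices since `n` is invertible. In case (ii), `D` becomes a matrix algebra of invertible size over
the algebraic closure. In case (i), Wedderburn's factorization of a minimal polynomial into factors
`X - a'`, with `a'` conjugate to `a`, makes `φ a` a multiple of `φ 1`. -/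

section

open Polynomial TensorProduct

/-! ### Functionals vanishing on commutators -/

/-- A linear functional on an algebra that vanishes on commutators. -/
def IsTraceFunctional {F A : Type*} [CommRing F] [Ring A] [Algebra F A] (φ : A →ₗ[F] F) : Prop :=
  ∀ x y, φ (x * y) = φ (y * x)

/-- Every functional that vanishes on commutators and at `1` is zero. -/
def TraceFunctionalsDetectedByOne (F A : Type*) [CommRing F] [Ring A] [Algebra F A] : Prop :=
  ∀ φ : A →ₗ[F] F, IsTraceFunctional φ → φ 1 = 0 → φ = 0

theorem TraceFunctionalsDetectedByOne.self (F : Type*) [CommRing F] :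
    TraceFunctionalsDetectedByOne F F := fun φ _ h => by
  ext; simpa using h

theorem TraceFunctionalsDetectedByOne.of_algEquiv {F A B : Type*} [CommRing F] [Ring A]
    [Algebra F A] [Ring B] [Algebra F B] (e : A ≃ₐ[F] B)
    (h : TraceFunctionalsDetectedByOne F A) : TraceFunctionalsDetectedByOne F B := by
  intro φ hφ h1
  have h0 : φ ∘ₗ e.toLinearMap = 0 := by
    apply h
    · intro x y
      simpa using hφ (e x) (e y)
    · simpa using h1
  ext b
  simpa using LinearMap.congr_fun h0 (e.symm b)

/-- Modulo commutators, off-diagonal units vanish and all diagonal positions agree, so `φ` is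
determined by its restriction to one corner, and `φ 1` is `n` times the corner value at `1`. -/
theorem TraceFunctionalsDetectedByOne.matrix {F D : Type*} [Field F] [Ring D] [Algebra F D]
    {n : ℕ} (hn : (n : F) ≠ 0) (h : TraceFunctionalsDetectedByOne F D) :
    TraceFunctionalsDetectedByOne F (Matrix (Fin n) (Fin n) D) := by
  intro φ hφ h1
  have hn0 : n ≠ 0 := by rintro rfl; simp at hn
  have : NeZero n := ⟨hn0⟩
  have hoff : ∀ i j d, i ≠ j → φ (Matrix.single i j d) = 0 := by
    intro i j d hij
    have := hφ (Matrix.single i i 1) (Matrix.single i j d)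
    rwa [Matrix.single_mul_single_same, Matrix.single_mul_single_of_ne _ _ _ _ hij.symm, one_mul,
      map_zero] at this
  have hdiag : ∀ i d, φ (Matrix.single i i d) = φ (Matrix.single 0 0 d) := by
    intro i d
    have := hφ (Matrix.single i 0 d) (Matrix.single 0 i 1)
    rwa [Matrix.single_mul_single_same, Matrix.single_mul_single_same, mul_one, one_mul] at this
  have hψ : φ ∘ₗ Matrix.singleLinearMap (α := D) F (0 : Fin n) (0 : Fin n) = 0 := by
    apply h
    · intro x y
      have := hφ (Matrix.single 0 0 x) (Matrix.single 0 0 y)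
      rwa [Matrix.single_mul_single_same, Matrix.single_mul_single_same] at this
    · have h2 : (1 : Matrix (Fin n) (Fin n) D) = ∑ i, Matrix.single i i 1 := by
        rw [Matrix.matrix_eq_sum_single 1]
        refine Finset.sum_congr rfl fun i _ => ?_
        rw [Finset.sum_eq_single i (fun j _ hj => by simp [Matrix.one_apply_ne' hj]) (by simp),
          Matrix.one_apply_eq]
      rw [h2, map_sum, Finset.sum_congr rfl fun i _ => hdiag i 1] at h1
      simpa [hn0, hn] using h1
  have h00 : ∀ d, φ (Matrix.single 0 0 d) = 0 := fun d => LinearMap.congr_fun hψ d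
  refine LinearMap.ext fun M => ?_
  rw [Matrix.matrix_eq_sum_single M]
  rw [map_sum, LinearMap.zero_apply]
  refine Finset.sum_eq_zero fun i _ => ?_
  rw [map_sum]
  refine Finset.sum_eq_zero fun j _ => ?_
  by_cases hij : i = j
  · subst hij; rw [hdiag, h00]
  · exact hoff i j _ hij

theorem TraceFunctionalsDetectedByOne.of_baseChange {F D : Type*} (K : Type*) [Field F] [Ring D]
    [Algebra F D] [Field K] [Algebra F K] (h : TraceFunctionalsDetectedByOne K (K ⊗[F] D)) :
    TraceFunctionalsDetectedByOne F D := by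
  intro φ hφ h1
  let Φ : K ⊗[F] D →ₗ[K] K := (TensorProduct.AlgebraTensorModule.rid F K K).toLinearMap ∘ₗ
    φ.baseChange K
  have hΦ : ∀ k d, Φ (k ⊗ₜ d) = φ d • k := fun k d => by simp [Φ]
  have h0 : Φ = 0 := by
    apply h
    · intro x y
      induction x using TensorProduct.induction_on with
      | zero => simp
      | add a b ha hb => rw [add_mul, mul_add, map_add, map_add, ha, hb]
      | tmul k d =>
        induction y using TensorProduct.induction_on with
        | zero => simp
        | add a b ha hb => rw [add_mul, mul_add, map_add, map_add, ha, hb]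
        | tmul k' d' =>
          rw [Algebra.TensorProduct.tmul_mul_tmul, Algebra.TensorProduct.tmul_mul_tmul, hΦ, hΦ,
            hφ d d', mul_comm]
    · rw [Algebra.TensorProduct.one_def, hΦ, h1, zero_smul]
  ext d
  have := hΦ 1 d
  rw [h0, LinearMap.zero_apply, Algebra.smul_def, mul_one] at this
  exact (map_eq_zero_iff _ (algebraMap F K).injective).1 this.symm

/-! ### Splitting a division algebra by scalar extension -/

/-- Shortest-element argument: scale one coordinate to `1`. A nonzero commutator with some `d ⊗ 1`
loses that coordinate and gains none; if all vanish, the coordinates are central and the element is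
an invertible `1 ⊗ k`. -/
theorem one_mem_of_ne_zero_mem_tensor {F D K : Type*} [Field F] [DivisionRing D] [Algebra F D]
    [Algebra.IsCentral F D] [Field K] [Algebra F K] (I : TwoSidedIdeal (D ⊗[F] K))
    {z : D ⊗[F] K} (hz : z ∈ I) (hz0 : z ≠ 0) : (1 : D ⊗[F] K) ∈ I := by
  classical
  let b := Module.Basis.ofVectorSpace F K
  let B := Algebra.TensorProduct.basis D b
  have hright : ∀ (z : D ⊗[F] K) (d : D) i, B.repr (z * (d ⊗ₜ 1)) i = B.repr z i * d := by
    intro z d i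
    induction z using TensorProduct.induction_on with
    | zero => simp
    | add x y hx hy => rw [add_mul, map_add, map_add, Finsupp.add_apply, Finsupp.add_apply, hx, hy,
        add_mul]
    | tmul e k =>
      simp only [Algebra.TensorProduct.tmul_mul_tmul, mul_one, B,
        Algebra.TensorProduct.basis_repr_tmul, Finsupp.smul_apply, Finsupp.mapRange_apply,
        smul_eq_mul]
      rw [mul_assoc, mul_assoc, Algebra.commutes]
  have hleft : ∀ (z : D ⊗[F] K) (d : D) i, B.repr ((d ⊗ₜ 1) * z) i = d * B.repr z i := by
    intro z d i
    have : (d ⊗ₜ 1 : D ⊗[F] K) * z = d • z := by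
      induction z using TensorProduct.induction_on with
      | zero => simp
      | add x y hx hy => rw [mul_add, smul_add, hx, hy]
      | tmul e k => simp [TensorProduct.smul_tmul']
    rw [this, map_smul, Finsupp.smul_apply, smul_eq_mul]
  have key : ∀ (N : ℕ) (z : D ⊗[F] K), z ∈ I → z ≠ 0 → (B.repr z).support.card = N →
      (1 : D ⊗[F] K) ∈ I := by
    intro N
    induction N using Nat.strong_induction_on with
    | _ N ih =>
    intro z hz hz0 hN
    have hne : B.repr z ≠ 0 := fun h => hz0 (B.repr.map_eq_zero_iff.1 h)
    obtain ⟨i, hi⟩ := Finsupp.ne_iff.1 hne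
    simp only [Finsupp.coe_zero, Pi.zero_apply] at hi
    set w : D ⊗[F] K := ((B.repr z i)⁻¹ ⊗ₜ 1) * z with hw
    have hwI : w ∈ I := I.mul_mem_left _ _ hz
    have hwr : ∀ j, B.repr w j = (B.repr z i)⁻¹ * B.repr z j := fun j => hleft _ _ _
    have hwi : B.repr w i = 1 := by rw [hwr, inv_mul_cancel₀ hi]
    by_cases hc : ∀ d : D, (d ⊗ₜ 1) * w - w * (d ⊗ₜ 1) = 0
    · have hcent : ∀ j, ∃ a : F, algebraMap F D a = B.repr w j := by
        intro j
        have : B.repr w j ∈ Subalgebra.center F D := by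
          rw [Subalgebra.mem_center_iff]
          intro d
          have := congrArg (fun y => B.repr y j) (hc d)
          simpa [hright, hleft, sub_eq_zero] using this
        have := Algebra.IsCentral.out this
        exact Algebra.mem_bot.1 this
      choose a ha using hcent
      have hwk : ∃ k : K, w = 1 ⊗ₜ k := by
        refine ⟨∑ j ∈ (B.repr w).support, a j • b j, ?_⟩
        conv_lhs => rw [← B.linearCombination_repr w]
        rw [Finsupp.linearCombination_apply, Finsupp.sum, TensorProduct.tmul_sum]
        refine Finset.sum_congr rfl fun j _ => ?_
        rw [← ha j, algebraMap_smul, Algebra.TensorProduct.basis_apply, TensorProduct.tmul_smul]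
      obtain ⟨k, hk⟩ := hwk
      have hk0 : k ≠ 0 := by
        rintro rfl
        rw [hk, TensorProduct.tmul_zero] at hwi
        simp at hwi
      have h1 : (1 : D ⊗[F] K) = (1 ⊗ₜ k⁻¹) * w := by
        rw [hk, Algebra.TensorProduct.tmul_mul_tmul, inv_mul_cancel₀ hk0, one_mul]; rfl
      rw [h1]
      exact I.mul_mem_left _ _ hwI
    · push Not at hc
      obtain ⟨d, hd⟩ := hc
      refine ih _ ?_ _ (I.sub_mem (I.mul_mem_left _ _ hwI) (I.mul_mem_right _ _ hwI)) hd rfl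
      rw [← hN]
      apply Finset.card_lt_card
      rw [Finset.ssubset_iff_of_subset]
      · refine ⟨i, by simpa using hi, ?_⟩
        simp [hright, hleft, hwi]
      · intro j hj
        rw [Finsupp.mem_support_iff] at hj ⊢
        intro h0
        apply hj
        have : B.repr w j = 0 := by rw [hwr, h0, mul_zero]
        simp [hright, hleft, this]
  exact key _ z hz hz0 rfl

theorem isSimpleRing_baseChange (F D K : Type*) [Field F] [DivisionRing D] [Algebra F D]
    [Algebra.IsCentral F D] [Field K] [Algebra F K] : IsSimpleRing (K ⊗[F] D) := by
  have : Nontrivial (K ⊗[F] D) := inferInstance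
  refine ⟨⟨fun I => ?_⟩⟩
  by_cases h : ∃ z ∈ I, z ≠ 0
  · obtain ⟨z, hz, hz0⟩ := h
    right
    let e := Algebra.TensorProduct.comm F D K
    have := one_mem_of_ne_zero_mem_tensor (I.comap e) (z := e.symm z)
      (by rw [TwoSidedIdeal.mem_comap]; simpa using hz) (by simpa using hz0)
    rw [TwoSidedIdeal.mem_comap, map_one] at this
    exact (TwoSidedIdeal.one_mem_iff I).1 this
  · left
    push Not at h
    exact le_antisymm (fun x hx => by simpa [TwoSidedIdeal.mem_bot] using h x hx) bot_le

theorem exists_baseChange_algEquiv_matrix (F D K : Type*) [Field F] [DivisionRing D] [Algebra F D]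
    [Algebra.IsCentral F D] [FiniteDimensional F D] [Field K] [Algebra F K] [IsAlgClosed K] :
    ∃ d : ℕ, Module.finrank F D = d * d ∧
      Nonempty ((K ⊗[F] D) ≃ₐ[K] Matrix (Fin d) (Fin d) K) := by
  have := isSimpleRing_baseChange F D K
  obtain ⟨d, -, ⟨e⟩⟩ := IsSimpleRing.exists_algEquiv_matrix_of_isAlgClosed K (K ⊗[F] D)
  refine ⟨d, ?_, ⟨e⟩⟩
  have := e.toLinearEquiv.finrank_eq
  rw [Module.finrank_baseChange, Module.finrank_matrix] at this
  simpa using this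

theorem TraceFunctionalsDetectedByOne.of_sqrt_finrank {F D : Type*} [Field F] [DivisionRing D]
    [Algebra F D] [Algebra.IsCentral F D] [FiniteDimensional F D]
    (h : (Nat.sqrt (Module.finrank F D) : F) ≠ 0) : TraceFunctionalsDetectedByOne F D := by
  obtain ⟨d, hd, ⟨e⟩⟩ := exists_baseChange_algEquiv_matrix F D (AlgebraicClosure F)
  rw [hd, Nat.sqrt_eq] at h
  refine .of_baseChange (AlgebraicClosure F) (.of_algEquiv e.symm (.matrix ?_ (.self _)))
  rw [← map_natCast (algebraMap F (AlgebraicClosure F))]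
  exact (map_ne_zero_iff _ (algebraMap F _).injective).2 h

/-! ### Polynomials over a division ring and Wedderburn factorization -/

theorem exists_eq_mul_X_sub_C_of_eval_eq_zero {R : Type*} [Ring R] {p : R[X]} {a : R}
    (h : p.eval a = 0) : ∃ q : R[X], p = q * (X - C a) := by
  have key : ∀ p : R[X], ∃ q : R[X], p - C (p.eval a) = q * (X - C a) := by
    intro p
    induction p using Polynomial.induction_on' with
    | add p q hp hq =>
      obtain ⟨r, hr⟩ := hp
      obtain ⟨s, hs⟩ := hq
      exact ⟨r + s, by rw [add_mul, ← hr, ← hs, eval_add, C_add]; abel⟩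
    | monomial n c =>
      refine ⟨C c * ∑ i ∈ Finset.range n, X ^ i * C a ^ (n - 1 - i), ?_⟩
      rw [mul_assoc, (Polynomial.commute_X (C a)).geom_sum₂_mul, eval_monomial, mul_sub, ← C_pow,
        ← C_mul, C_mul_X_pow_eq_monomial]
  obtain ⟨q, hq⟩ := key p
  exact ⟨q, by rw [← hq, h, C_0, sub_zero]⟩

theorem eval_monomial_mul_noncomm {R : Type*} [Ring R] (n : ℕ) (c : R) (q : R[X]) (b : R) :
    (monomial n c * q).eval b = c * (q.eval b * b ^ n) := by
  rw [← C_mul_X_pow_eq_monomial, mul_assoc, eval_C_mul, (X_pow_mul : X ^ n * q = q * X ^ n),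
    eval_mul_X_pow]

/-- Evaluation keeps coefficients on the left, so it is not multiplicative; moving `q.eval b` past
powers of `b` conjugates `b`. -/
theorem eval_mul_eq_eval_conj_mul {D : Type*} [DivisionRing D] (p q : D[X]) (b : D)
    (h : q.eval b ≠ 0) :
    (p * q).eval b = p.eval (q.eval b * b * (q.eval b)⁻¹) * q.eval b := by
  induction p using Polynomial.induction_on' with
  | add p r hp hr => rw [add_mul, eval_add, eval_add, hp, hr, add_mul]
  | monomial n c =>
    have hconj := GroupWithZero.conj_pow₀ (s := n) (d := b) (inv_ne_zero h)
    rw [inv_inv] at hconj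
    rw [eval_monomial_mul_noncomm, eval_monomial, mul_assoc, hconj, inv_mul_cancel_right₀ h]

section Wedderburn

variable {F D : Type*} [Field F] [DivisionRing D] [Algebra F D]

/-- Take `p` monic. If its coefficients are central, it lies in `F[X]` and kills `a`. Otherwise its
commutator with a constant is nonzero, of smaller degree, and still vanishes on the conjugacy class.
-/
theorem natDegree_minpoly_le_of_eval_conj_eq_zero [Algebra.IsCentral F D] (a : D) (p : D[X])
    (hp : p ≠ 0) (hroot : ∀ u : D, u ≠ 0 → p.eval (u * a * u⁻¹) = 0) :
    (minpoly F a).natDegree ≤ p.natDegree := by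
  induction hN : p.natDegree using Nat.strong_induction_on generalizing p with
  | _ N ih =>
  have hlead : p.leadingCoeff ≠ 0 := leadingCoeff_ne_zero.2 hp
  obtain ⟨q, hq, hqN, hqroot⟩ : ∃ q : D[X], q.Monic ∧ q.natDegree = N ∧
      ∀ u : D, u ≠ 0 → q.eval (u * a * u⁻¹) = 0 := by
    refine ⟨C p.leadingCoeff⁻¹ * p, ?_, ?_, fun u hu => ?_⟩
    · rw [Monic, leadingCoeff_mul, leadingCoeff_C, inv_mul_cancel₀ hlead]
    · rw [natDegree_C_mul (inv_ne_zero hlead), hN]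
    · rw [eval_C_mul, hroot u hu, mul_zero]
  by_cases hc : ∀ (u : D) i, u * q.coeff i = q.coeff i * u
  · have hcoeff : ∀ i, ∃ c : F, algebraMap F D c = q.coeff i := fun i =>
      Algebra.mem_bot.1 (Algebra.IsCentral.out (Subalgebra.mem_center_iff.2 fun u => hc u i))
    obtain ⟨r, hr⟩ : ∃ r : F[X], r.map (algebraMap F D) = q := by
      rw [← Polynomial.mem_lifts, Polynomial.lifts_iff_coeff_lifts]
      exact hcoeff
    have hr0 : r ≠ 0 := by
      rintro rfl
      exact hq.ne_zero (by rw [← hr, Polynomial.map_zero])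
    have := natDegree_le_natDegree <| minpoly.degree_le_of_ne_zero F a hr0 (by
      have := hqroot 1 one_ne_zero
      rwa [one_mul, inv_one, mul_one, ← hr, eval_map_algebraMap] at this)
    rwa [← hqN, ← hr, natDegree_map]
  · push Not at hc
    obtain ⟨u, i, hui⟩ := hc
    have hu : u ≠ 0 := by rintro rfl; simp at hui
    have hs0 : C u * q - q * C u ≠ 0 := fun h => hui <| by
      have := congrArg (fun r => coeff r i) h
      simpa [sub_eq_zero] using this
    have hdeg : (C u * q - q * C u).natDegree < N := by
      have hle : (C u * q - q * C u).natDegree ≤ N := by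
        rw [← hqN]
        refine (natDegree_sub_le _ _).trans (max_le (natDegree_C_mul_le _ _) (natDegree_mul_C_le _ _))
      refine lt_of_le_of_ne hle fun heq => hs0 ?_
      rw [← leadingCoeff_eq_zero, leadingCoeff, heq, coeff_sub, coeff_C_mul, coeff_mul_C, ← hqN,
        hq.coeff_natDegree, mul_one, one_mul, sub_self]
    refine (ih _ hdeg _ hs0 (fun v hv => ?_) rfl).trans hdeg.le
    have h1 := eval_mul_eq_eval_conj_mul q (C u) (v * a * v⁻¹) (by rwa [eval_C])
    rw [eval_C, show u * (v * a * v⁻¹) * u⁻¹ = (u * v) * a * (u * v)⁻¹ by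
      rw [mul_inv_rev]; simp only [mul_assoc], hqroot _ (mul_ne_zero hu hv), zero_mul] at h1
    rw [eval_sub, eval_C_mul, hqroot v hv, h1, mul_zero, sub_zero]

/-- Linear factors `X - a'` are peeled off one at a time, each `a'` conjugate to `a`; `nextCoeff` is
minus the sum of these `a'`, and `φ` is constant on conjugates. -/
theorem exists_right_factor_minpoly [Algebra.IsCentral F D] {a : D}
    {φ : D →ₗ[F] F} (hφ : IsTraceFunctional φ) (k : ℕ) (hk : k ≤ (minpoly F a).natDegree) :
    ∃ h q : D[X], (minpoly F a).map (algebraMap F D) = h * q ∧ q.Monic ∧ q.natDegree = k ∧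
      φ q.nextCoeff = -(k * φ a) := by
  induction k with
  | zero => exact ⟨_, 1, (mul_one _).symm, monic_one, natDegree_one, by
      rw [← map_one (C : D →+* D[X]), nextCoeff_C_eq_zero]; simp⟩
  | succ k ih =>
    obtain ⟨h, q, hg, hq, hqk, hφq⟩ := ih (by omega)
    obtain ⟨u, hu, hroot⟩ : ∃ u : D, u ≠ 0 ∧ q.eval (u * a * u⁻¹) ≠ 0 := by
      by_contra! hcon
      have := natDegree_minpoly_le_of_eval_conj_eq_zero (F := F) a q hq.ne_zero hcon
      omega
    set b := u * a * u⁻¹ with hb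
    set w := q.eval b with hw
    have hgb : ((minpoly F a).map (algebraMap F D)).eval b = 0 := by
      have h1 := eval_mul_eq_eval_conj_mul ((minpoly F a).map (algebraMap F D)) (C u) a
        (by rwa [eval_C])
      have h2 : (minpoly F a).map (algebraMap F D) * C u =
          C u * (minpoly F a).map (algebraMap F D) := by
        ext i
        rw [coeff_mul_C, coeff_C_mul, coeff_map, Algebra.commutes]
      rw [h2, eval_C_mul, eval_map_algebraMap, minpoly.aeval, mul_zero, eval_C] at h1
      exact (mul_eq_zero.1 h1.symm).resolve_right hu
    -- Since `q` does not vanish at `b`, the cofactor `h` must vanish at the conjugate `w * b *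
    -- w⁻¹`.
    rw [hg, eval_mul_eq_eval_conj_mul _ _ _ hroot] at hgb
    obtain ⟨r, hr⟩ := exists_eq_mul_X_sub_C_of_eval_eq_zero ((mul_eq_zero.1 hgb).resolve_right hroot)
    refine ⟨r, (X - C (w * b * w⁻¹)) * q, ?_, (monic_X_sub_C _).mul hq, ?_, ?_⟩
    · rw [hg, hr, mul_assoc]
    · rw [(monic_X_sub_C _).natDegree_mul hq, natDegree_X_sub_C, hqk, add_comm]
    · have hconj : ∀ (v : D) x, v ≠ 0 → φ (v * x * v⁻¹) = φ x := fun v x hv => by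
        rw [hφ, ← mul_assoc, inv_mul_cancel₀ hv, one_mul]
      rw [(monic_X_sub_C _).nextCoeff_mul hq, nextCoeff_X_sub_C, map_add, map_neg,
        hconj w _ hroot, hb, hconj u _ hu, hφq]
      push_cast
      ring

theorem IsTraceFunctional.natDegree_minpoly_mul [Algebra.IsCentral F D] {a : D}
    (ha : IsIntegral F a) {φ : D →ₗ[F] F} (hφ : IsTraceFunctional φ) :
    (minpoly F a).natDegree * φ a = -((minpoly F a).nextCoeff * φ 1) := by
  obtain ⟨h, q, hg, hq, hqk, hφq⟩ := exists_right_factor_minpoly hφ _ le_rfl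
  have hgm : ((minpoly F a).map (algebraMap F D)).Monic := (minpoly.monic ha).map _
  have hh : h.Monic := by
    rw [hg] at hgm
    exact hq.of_mul_monic_right hgm
  have hh1 : h = 1 := by
    rw [← hh.natDegree_eq_zero]
    have := congrArg natDegree hg
    rw [hh.natDegree_mul hq, natDegree_map, hqk] at this
    omega
  rw [hh1, one_mul] at hg
  rw [← hg, nextCoeff_map (algebraMap F D).injective, Algebra.algebraMap_eq_smul_one, map_smul,
    smul_eq_mul] at hφq
  rw [hφq, neg_neg]

theorem TraceFunctionalsDetectedByOne.of_isAlgebraic [Algebra.IsCentral F D] [CharZero F]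
    (h : Algebra.IsAlgebraic F D) : TraceFunctionalsDetectedByOne F D := by
  intro φ hφ h1
  ext a
  have ha : IsIntegral F a := (h.isAlgebraic a).isIntegral
  have := hφ.natDegree_minpoly_mul ha
  rw [h1, mul_zero, neg_zero, mul_eq_zero, Nat.cast_eq_zero] at this
  exact this.resolve_left (minpoly.natDegree_pos ha).ne'

end Wedderburn

/-! ### Lie ideals of simple rings -/

theorem eq_zero_or_eq_zero_of_forall_mul_mul_eq_zero {A : Type*} [Ring A] [IsSimpleRing A]
    {x y : A} (h : ∀ a, x * a * y = 0) : x = 0 ∨ y = 0 := by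
  by_contra! hxy
  let I : TwoSidedIdeal A := TwoSidedIdeal.mk' {z | ∀ a, x * a * z = 0}
    (by simp) (fun {u v} hu hv a => by rw [mul_add, hu a, hv a, add_zero])
    (fun {u} hu a => by rw [mul_neg, hu a, neg_zero])
    (fun {u v} hv a => by
      have := hv (a * u)
      simpa only [mul_assoc] using this)
    (fun {u v} hu a => by rw [← mul_assoc, hu a, zero_mul])
  have h1 : (1 : A) ∈ I := IsSimpleRing.one_mem_of_ne_zero_mem I hxy.2 <| by
    simpa [I, TwoSidedIdeal.mem_mk'] using h
  have h2 : ∀ a, x * a * 1 = 0 := by simpa [I, TwoSidedIdeal.mem_mk'] using h1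
  exact hxy.1 (by simpa using h2 1)

theorem exists_mul_eq_one_of_central {A : Type*} [Ring A] [IsSimpleRing A]
    {s : A} (hs : s ≠ 0) (hc : ∀ a, s * a = a * s) : ∃ a, s * a = 1 := by
  let I : TwoSidedIdeal A := TwoSidedIdeal.mk' {z | ∃ a, s * a = z}
    ⟨0, mul_zero s⟩
    (by rintro _ _ ⟨a, rfl⟩ ⟨b, rfl⟩; exact ⟨a + b, mul_add _ _ _⟩)
    (by rintro _ ⟨a, rfl⟩; exact ⟨-a, mul_neg _ _⟩)
    (by rintro x _ ⟨a, rfl⟩; exact ⟨x * a, by rw [← mul_assoc, hc, mul_assoc]⟩)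
    (by rintro _ y ⟨a, rfl⟩; exact ⟨a * y, (mul_assoc _ _ _).symm⟩)
  have h1 : (1 : A) ∈ I := IsSimpleRing.one_mem_of_ne_zero_mem I hs <| by
    rw [TwoSidedIdeal.mem_mk']; exact ⟨1, mul_one s⟩
  rwa [TwoSidedIdeal.mem_mk'] at h1

section Lie

variable {A : Type*} [Ring A]

/-- The subring of all elements whose commutators with the whole ring lie in `L`, for a
Lie ideal `L`. -/
def lieTransporter (L : AddSubgroup A) : Subring A where
  carrier := {x | ∀ a, x * a - a * x ∈ L}
  zero_mem' a := by simp
  one_mem' a := by simp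
  neg_mem' {x} hx a := by
    have := L.neg_mem (hx a)
    rwa [show -x * a - a * -x = -(x * a - a * x) by noncomm_ring]
  add_mem' {x y} hx hy a := by
    have := L.add_mem (hx a) (hy a)
    rwa [show (x + y) * a - a * (x + y) = x * a - a * x + (y * a - a * y) by noncomm_ring]
  mul_mem' {x y} hx hy a := by
    have := L.add_mem (hx (y * a)) (hy (a * x))
    rwa [show x * y * a - a * (x * y) = x * (y * a) - y * a * x + (y * (a * x) - a * x * y) by
      noncomm_ring]

theorem mem_lieTransporter {L : AddSubgroup A} {x : A} :
    x ∈ lieTransporter L ↔ ∀ a, x * a - a * x ∈ L := Iff.rfl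

/-- An additive subgroup is a Lie ideal if it is closed under commutators with all elements. -/
def IsLieIdeal (L : AddSubgroup A) : Prop := ∀ x ∈ L, ∀ a, x * a - a * x ∈ L

variable {L : AddSubgroup A}

theorem IsLieIdeal.le_lieTransporter (hL : IsLieIdeal L) {x : A} (hx : x ∈ L) :
    x ∈ lieTransporter L := hL x hx

theorem IsLieIdeal.lie_mem_lieTransporter (hL : IsLieIdeal L) {x : A} (hx : x ∈ lieTransporter L)
    (a : A) : x * a - a * x ∈ lieTransporter L :=
  hL.le_lieTransporter (hx a)

/-- The transporter is a subring and a Lie ideal; these two closures put the whole two-sided ideal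
generated by `[x, y]` inside it. -/
theorem IsLieIdeal.lieTransporter_eq_top [IsSimpleRing A] (hL : IsLieIdeal L) {x y : A}
    (hx : x ∈ lieTransporter L) (hy : y ∈ lieTransporter L) (hxy : x * y ≠ y * x) :
    lieTransporter L = ⊤ := by
  have h1 : ∀ a, (x * y - y * x) * a ∈ lieTransporter L := fun a => by
    have := (lieTransporter L).sub_mem (hL.lie_mem_lieTransporter hx (y * a))
      ((lieTransporter L).mul_mem hy (hL.lie_mem_lieTransporter hx a))
    rwa [show x * (y * a) - y * a * x - y * (x * a - a * x) = (x * y - y * x) * a by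
      noncomm_ring] at this
  have h2 : ∀ a b, a * (x * y - y * x) * b ∈ lieTransporter L := fun a b => by
    have := (lieTransporter L).sub_mem (h1 (b * a)) (hL.lie_mem_lieTransporter (h1 b) a)
    rwa [show (x * y - y * x) * (b * a) - ((x * y - y * x) * b * a - a * ((x * y - y * x) * b)) =
      a * (x * y - y * x) * b by noncomm_ring] at this
  let I : TwoSidedIdeal A := TwoSidedIdeal.mk' {z | ∀ a b, a * z * b ∈ lieTransporter L}
    (by simp)
    (fun {u v} hu hv a b => by
      rw [mul_add, add_mul]; exact (lieTransporter L).add_mem (hu a b) (hv a b))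
    (fun {u} hu a b => by
      rw [mul_neg, neg_mul]; exact (lieTransporter L).neg_mem (hu a b))
    (fun {u v} hv a b => by rw [← mul_assoc]; exact hv _ _)
    (fun {u v} hu a b => by rw [← mul_assoc, mul_assoc]; exact hu _ _)
  have hI : (1 : A) ∈ I := IsSimpleRing.one_mem_of_ne_zero_mem I (sub_ne_zero.2 hxy) <| by
    rw [TwoSidedIdeal.mem_mk']; exact h2
  rw [TwoSidedIdeal.mem_mk'] at hI
  refine eq_top_iff.2 fun z _ => ?_
  simpa using hI z 1

theorem IsLieIdeal.lie_lie_eq_zero (hL : IsLieIdeal L)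
    (hcomm : ∀ x ∈ lieTransporter L, ∀ y ∈ lieTransporter L, x * y = y * x)
    {x : A} (hx : x ∈ lieTransporter L) (a : A) :
    x * (x * a - a * x) - (x * a - a * x) * x = 0 :=
  sub_eq_zero.2 (hcomm _ hx _ (hL.lie_mem_lieTransporter hx a))

/-- In a simple ring without `2`-torsion, an element with `ad x ^ 2 = 0` is central. -/
theorem commute_of_lie_lie_eq_zero [IsSimpleRing A] (h2 : ∀ a : A, a + a = 0 → a = 0) {x : A}
    (hx : ∀ a, x * (x * a - a * x) - (x * a - a * x) * x = 0) (a : A) : x * a = a * x := by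
  -- Leibniz for `δ = ad x`: `δ²(ab) = δ²(a)b + 2δ(a)δ(b) + aδ²(b)`.
  have h1 : ∀ a b, (x * a - a * x) * (x * b - b * x) = 0 := fun a b => by
    apply h2
    have e : (x * a - a * x) * (x * b - b * x) + (x * a - a * x) * (x * b - b * x) =
      (x * (x * (a * b) - a * b * x) - (x * (a * b) - a * b * x) * x) -
      (x * (x * a - a * x) - (x * a - a * x) * x) * b -
      a * (x * (x * b - b * x) - (x * b - b * x) * x) := by noncomm_ring
    rw [e, hx, hx, hx]; simp
  have h3 : ∀ c, (x * a - a * x) * c * (x * a - a * x) = 0 := fun c => by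
    have e : (x * a - a * x) * c * (x * a - a * x) =
      (x * a - a * x) * (x * (c * a) - c * a * x) - (x * a - a * x) * (x * c - c * x) * a := by
      noncomm_ring
    rw [e, h1, h1]; simp
  exact sub_eq_zero.1 ((eq_zero_or_eq_zero_of_forall_mul_mul_eq_zero h3).elim id id)

/-- In characteristic `2`, `ad x ^ 2 = ad (x ^ 2)`. -/
theorem commute_mul_self_of_lie_lie_eq_zero (h2 : ∀ a : A, a + a = 0) {x : A}
    (hx : ∀ a, x * (x * a - a * x) - (x * a - a * x) * x = 0) (a : A) :
    x * x * a = a * (x * x) := by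
  have e : x * x * a - a * (x * x) = (x * (x * a - a * x) - (x * a - a * x) * x) +
    (x * a * x - a * x * x + (x * a * x - a * x * x)) := by noncomm_ring
  rw [← sub_eq_zero, e, hx, h2, add_zero]

theorem eq_zero_of_lie_mul_self_eq_zero [IsSimpleRing A] {x : A} (hx : x * x = 0)
    (h : ∀ a, (x * a - a * x) * (x * a - a * x) = 0) : x = 0 := by
  have hx' : ∀ b, x * (x * b) = 0 := fun b => by rw [← mul_assoc, hx, zero_mul]
  have h1 : ∀ a, x * (a * (x * (a * x))) = 0 := fun a => by
    have h' := congrArg (fun t => x * t) (h a)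
    simp only [mul_sub, sub_mul, mul_assoc, hx', mul_zero, sub_zero, zero_sub] at h'
    simpa using h'
  -- Linearization of `h1`; putting `b * x * a` for `b` then gives `(xax)b(xax) = 0`.
  have h3 : ∀ a b, x * (a * (x * (b * x))) = - (x * (b * (x * (a * x)))) := fun a b => by
    have := h1 (a + b)
    simp only [add_mul, mul_add, h1, zero_add, add_zero] at this
    rw [eq_neg_iff_add_eq_zero, ← this]
    abel
  have h4 : ∀ a, x * a * x = 0 := fun a => by
    refine (eq_zero_or_eq_zero_of_forall_mul_mul_eq_zero (x := x * a * x) (y := x * a * x)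
      fun b => ?_).elim id id
    have := h3 a (b * (x * a))
    simp only [mul_assoc] at this ⊢
    rw [this, h1 a]; simp
  exact (eq_zero_or_eq_zero_of_forall_mul_mul_eq_zero h4).elim id id

/-- If `w = [u, y]` has `w² ≠ 0`, then `w²` is central, hence invertible, and `z = y * w⁻¹`
satisfies `[u, z] = 1`. Left multiplication by `z` is then a contracting homotopy for the
differential `ad u`, so kernel equals image and the dimension is even. -/
theorem IsLieIdeal.lie_mul_self_eq_zero_of_odd_finrank {F : Type*} [Field F] [Algebra F A]
    [FiniteDimensional F A] [IsSimpleRing A] (hodd : Odd (Module.finrank F A))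
    (h2 : ∀ a : A, a + a = 0) (hL : IsLieIdeal L)
    (hcomm : ∀ x ∈ lieTransporter L, ∀ y ∈ lieTransporter L, x * y = y * x)
    {u : A} (hu : u ∈ lieTransporter L) (y : A) :
    (u * y - y * u) * (u * y - y * u) = 0 := by
  by_contra hw0
  set w := u * y - y * u with hw
  have hwT : w ∈ lieTransporter L := hL.lie_mem_lieTransporter hu y
  have hwc := commute_mul_self_of_lie_lie_eq_zero h2 (hL.lie_lie_eq_zero hcomm hwT)
  obtain ⟨c, hc⟩ := exists_mul_eq_one_of_central hw0 hwc
  have hcu : u * c = c * u := by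
    have e : w * w * (u * c) = w * w * (c * u) := by
      rw [← mul_assoc, hwc u, mul_assoc, hc, ← mul_assoc, hc, mul_one, one_mul]
    have := congrArg (fun t => c * t) e
    simpa only [← mul_assoc, ← hwc c, hc, one_mul, mul_assoc c w w] using this
  have hwu : u * w = w * u := hcomm u hu w hwT
  have hz : u * (y * (w * c)) - y * (w * c) * u = 1 := by
    have e : y * (w * c) * u = y * u * (w * c) := by
      rw [mul_assoc, mul_assoc w, ← hcu, ← mul_assoc w, ← hwu]; simp only [mul_assoc]
    rw [e, ← mul_assoc, ← sub_mul, ← hw, ← mul_assoc, hc]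
  let δ : A →ₗ[F] A := LinearMap.mulLeft F u - LinearMap.mulRight F u
  have hδ : ∀ a, δ a = u * a - a * u := fun a => rfl
  have hker : LinearMap.ker δ = LinearMap.range δ := by
    apply le_antisymm
    · intro v hv
      rw [LinearMap.mem_ker, hδ] at hv
      refine ⟨y * (w * c) * v, ?_⟩
      have e : δ (y * (w * c) * v) = (u * (y * (w * c)) - y * (w * c) * u) * v +
          y * (w * c) * (u * v - v * u) := by rw [hδ]; noncomm_ring
      rw [e, hz, hv, one_mul, mul_zero, add_zero]
    · rintro _ ⟨v, rfl⟩
      rw [LinearMap.mem_ker, hδ, hδ]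
      exact hL.lie_lie_eq_zero hcomm hu v
  have := LinearMap.finrank_range_add_finrank_ker δ
  rw [hker] at this
  rw [← this, ← two_mul] at hodd
  exact (Nat.not_odd_iff_even.2 (even_two_mul _)) hodd

theorem IsLieIdeal.lieTransporter_eq_top_of_not_central {F : Type*} [Field F] [Algebra F A]
    [IsSimpleRing A] (hF : (2 : F) ≠ 0 ∨ FiniteDimensional F A ∧ Odd (Module.finrank F A))
    (hL : IsLieIdeal L) {u y : A} (hu : u ∈ L) (huy : u * y ≠ y * u) :
    lieTransporter L = ⊤ := by
  by_contra htop
  have hcomm : ∀ x ∈ lieTransporter L, ∀ y ∈ lieTransporter L, x * y = y * x := by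
    intro x hx y hy
    by_contra hxy
    exact htop (hL.lieTransporter_eq_top hx hy hxy)
  have huT := hL.le_lieTransporter hu
  by_cases h2 : (2 : F) = 0
  · obtain ⟨_, hodd⟩ := hF.resolve_left (not_not.2 h2)
    have h2' : ∀ a : A, a + a = 0 := fun a => by
      rw [← two_smul F, h2, zero_smul]
    have hsq := fun {u : A} (hu : u ∈ lieTransporter L) (y : A) =>
      hL.lie_mul_self_eq_zero_of_odd_finrank hodd h2' hcomm hu y
    -- The commutator `[u, y]` squares to zero, and so do its own commutators, as it again lies in
    -- the transporter.
    exact huy (sub_eq_zero.1 (eq_zero_of_lie_mul_self_eq_zero (hsq huT y)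
      (hsq (hL.lie_mem_lieTransporter huT y))))
  · refine huy (commute_of_lie_lie_eq_zero (fun a ha => ?_) (hL.lie_lie_eq_zero hcomm huT) y)
    rw [← two_smul F] at ha
    exact (smul_eq_zero.1 ha).resolve_left h2

end Lie

/-! ### Values of noncommutative polynomials -/

/-- A functional killing `V` turns `p` into a polynomial over `F` that vanishes on all of the
infinite field. -/
theorem coeff_mem_of_eval_algebraMap_mem {F A : Type*} [Field F] [Infinite F] [Ring A]
    [Algebra F A] (V : Submodule F A) (p : A[X]) (h : ∀ t : F, p.eval (algebraMap F A t) ∈ V)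
    (k : ℕ) : p.coeff k ∈ V := by
  by_contra hk
  obtain ⟨φ, hφ, hV⟩ := Submodule.exists_le_ker_of_notMem hk
  let q : F[X] := ∑ i ∈ Finset.range (p.natDegree + 1), C (φ (p.coeff i)) * X ^ i
  have hq : q = 0 := by
    refine Polynomial.funext fun t => ?_
    have h1 : φ (p.eval (algebraMap F A t)) = 0 := hV (h t)
    rw [eval_eq_sum_range, map_sum] at h1
    rw [eval_zero, ← h1, eval_finsetSum]
    refine Finset.sum_congr rfl fun i _ => ?_
    rw [← map_pow, ← Algebra.commutes, ← Algebra.smul_def, map_smul, eval_mul, eval_C, eval_pow,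
      eval_X, smul_eq_mul, mul_comm]
  apply hφ
  have h2 : q.coeff k = 0 := by rw [hq, coeff_zero]
  rw [finsetSum_coeff] at h2
  by_cases hkd : k ≤ p.natDegree
  · simpa [coeff_X_pow, Nat.lt_succ_iff, hkd] using h2
  · rw [coeff_eq_zero_of_natDegree_lt (not_le.1 hkd), map_zero]

section FreeAlgebra

variable {F A X : Type*} [CommRing F] [Ring A] [Algebra F A]

theorem coeff_zero_lift_linear_perturbation (a b : X → A) (f : FreeAlgebra F X) :
    (FreeAlgebra.lift F (fun i => C (a i) + C (b i) * Polynomial.X) f).coeff 0 =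
      FreeAlgebra.lift F a f := by
  induction f using FreeAlgebra.induction with
  | grade0 r => simp [Polynomial.algebraMap_apply]
  | grade1 i => simp
  | mul f g hf hg => rw [map_mul, mul_coeff_zero, hf, hg, map_mul]
  | add f g hf hg => rw [map_add, coeff_add, hf, hg, map_add]

/-- First-order perturbation along the derivation `[·, x]` obeys the Leibniz rule on `f`. -/
theorem coeff_one_lift_commutator_perturbation (a : X → A) (x : A) (f : FreeAlgebra F X) :
    (FreeAlgebra.lift F (fun i => C (a i) + C (a i * x - x * a i) * Polynomial.X) f).coeff 1 =
      FreeAlgebra.lift F a f * x - x * FreeAlgebra.lift F a f := by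
  induction f using FreeAlgebra.induction with
  | grade0 r => simp [Polynomial.algebraMap_apply, Algebra.commutes]
  | grade1 i => simp [coeff_C]
  | mul f g hf hg =>
    rw [map_mul, mul_coeff_one, hf, hg, map_mul, coeff_zero_lift_linear_perturbation,
      coeff_zero_lift_linear_perturbation]
    noncomm_ring
  | add f g hf hg => rw [map_add, coeff_add, hf, hg, map_add]; noncomm_ring

theorem eval_algebraMap_lift (p : X → A[X]) (t : F) (f : FreeAlgebra F X) :
    (FreeAlgebra.lift F p f).eval (algebraMap F A t) =
      FreeAlgebra.lift F (fun i => (p i).eval (algebraMap F A t)) f := by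
  let ev : A[X] →ₐ[F] A :=
    { eval₂RingHom' (RingHom.id A) (algebraMap F A t) fun a => (Algebra.commutes t a).symm with
      commutes' := fun r => by
        rw [Polynomial.algebraMap_apply]
        exact eval_C }
  have hev : ∀ p, ev p = p.eval (algebraMap F A t) := fun p => rfl
  have h : ev.comp (FreeAlgebra.lift F p) =
      FreeAlgebra.lift F (fun i => (p i).eval (algebraMap F A t)) := by
    ext i
    simp [hev]
  rw [← h, AlgHom.comp_apply, hev]

end FreeAlgebra

namespace NCPoly

theorem isLieIdeal_span_image {F A : Type*} [Field F] [Infinite F] [Ring A] [Algebra F A]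
    (f : FreeAlg F) : IsLieIdeal (Submodule.span F (image f A)).toAddSubgroup := by
  intro v hv x
  rw [Submodule.mem_toAddSubgroup] at hv ⊢
  induction hv using Submodule.span_induction with
  | mem v hv =>
    obtain ⟨a, rfl⟩ := hv
    dsimp only
    rw [← coeff_one_lift_commutator_perturbation]
    refine coeff_mem_of_eval_algebraMap_mem _ _ (fun t => ?_) 1
    rw [eval_algebraMap_lift]
    exact Submodule.subset_span ⟨_, rfl⟩
  | zero => simp
  | add v w _ _ hv hw =>
    rw [show (v + w) * x - x * (v + w) = v * x - x * v + (w * x - x * w) by noncomm_ring]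
    exact add_mem hv hw
  | smul c v _ hv =>
    rw [smul_mul_assoc, mul_smul_comm, ← smul_sub]
    exact Submodule.smul_mem _ c hv

theorem center_sup_span_image_eq_top {F A : Type*} [Field F] [Infinite F] [Ring A]
    [IsSimpleRing A] [Algebra F A] (htr : TraceFunctionalsDetectedByOne F A)
    (hF : (2 : F) ≠ 0 ∨ FiniteDimensional F A ∧ Odd (Module.finrank F A))
    (f : FreeAlg F) (hf : ¬ image f A ⊆ Set.center A) :
    Subalgebra.toSubmodule (Subalgebra.center F A) ⊔ Submodule.span F (image f A) = ⊤ := by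
  obtain ⟨u, hu, huc⟩ := Set.not_subset.1 hf
  obtain ⟨y, huy⟩ : ∃ y, u * y ≠ y * u := by
    by_contra! h
    exact huc (Semigroup.mem_center_iff.2 fun y => (h y).symm)
  have htop := (isLieIdeal_span_image f).lieTransporter_eq_top_of_not_central hF
    ((Submodule.mem_toAddSubgroup _).2 (Submodule.subset_span hu)) huy
  have hcomm : ∀ x y : A, x * y - y * x ∈ Submodule.span F (image f A) := fun x y =>
    mem_lieTransporter.1 (htop ▸ Subring.mem_top x) y
  by_contra hne
  obtain ⟨φ, hφ, hker⟩ := Submodule.exists_le_ker_of_lt_top _ (lt_top_iff_ne_top.2 hne)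
  refine hφ (htr φ (fun x y => ?_) ?_)
  · rw [← sub_eq_zero, ← map_sub]
    exact hker (Submodule.mem_sup_right (hcomm x y))
  · exact hker (Submodule.mem_sup_left (Subalgebra.one_mem _))

/-! ### Consequences of the two admissible cases -/

theorem Admissible.traceFunctionalsDetectedByOne {D : Type*} [DivisionRing D]
    [Algebra.IsCentral (Subring.center D) D] {n : ℕ} (hn : 1 ≤ n) (h : Admissible D n) :
    TraceFunctionalsDetectedByOne (Subring.center D) (Matrix (Fin n) (Fin n) D) := by
  rcases h with ⟨halg, _⟩ | ⟨_, p, _, _, hpD, hpn⟩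
  · have : CharZero (Subring.center D) :=
      ⟨fun a b hab => Nat.cast_injective (R := D) (by simpa using congrArg Subtype.val hab)⟩
    exact .matrix (Nat.cast_ne_zero.2 (by omega)) (.of_isAlgebraic halg)
  · refine .matrix ?_ (.of_sqrt_finrank ?_)
    · rwa [Ne, CharP.cast_eq_zero_iff _ p]
    · rwa [Ne, CharP.cast_eq_zero_iff _ p]

/-- In characteristic 2 only case (ii) survives, with `p = 2`; the dimension is `n²d²` with `n` and
`d` odd. -/
theorem Admissible.two_ne_zero_or_odd_finrank {D : Type*} [DivisionRing D]
    [Algebra.IsCentral (Subring.center D) D] {n : ℕ} (h : Admissible D n) :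
    (2 : Subring.center D) ≠ 0 ∨ FiniteDimensional (Subring.center D) (Matrix (Fin n) (Fin n) D) ∧
      Odd (Module.finrank (Subring.center D) (Matrix (Fin n) (Fin n) D)) := by
  refine or_iff_not_imp_left.2 fun h2 => ?_
  rw [not_not] at h2
  rcases h with ⟨_, _⟩ | ⟨_, p, hp, _, hpD, hpn⟩
  · exact absurd (congrArg Subtype.val h2) (by simp)
  · refine ⟨inferInstance, ?_⟩
    have hp2 : p ∣ 2 := by
      rw [← CharP.cast_eq_zero_iff (Subring.center D) p]
      exact_mod_cast h2
    have hp1 : p ≠ 1 := CharP.char_ne_one (Subring.center D) p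
    obtain rfl : p = 2 := ((Nat.dvd_prime Nat.prime_two).1 hp2).resolve_left hp1
    obtain ⟨d, hd, -⟩ := exists_baseChange_algEquiv_matrix (Subring.center D) D
      (AlgebraicClosure (Subring.center D))
    rw [hd, Nat.sqrt_eq] at hpD
    rw [Module.finrank_matrix, hd, Fintype.card_fin]
    simp only [← even_iff_two_dvd, Nat.not_even_iff_odd] at hpD hpn
    exact (hpn.mul hpn).mul (hpD.mul hpD)

end NCPoly

end

theorem theorem2 (D : Type*) [DivisionRing D] (hF : Infinite (Subring.center D))
    (n : ℕ) (hn : 1 ≤ n) (hD : NCPoly.Admissible D n)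
    (f : NCPoly.FreeAlg (Subring.center D))
    (hf_id : ¬ NCPoly.IsPolynomialIdentity f (Matrix (Fin n) (Fin n) D))
    (hf_central : ¬ NCPoly.IsCentralPolynomial f (Matrix (Fin n) (Fin n) D)) :
    Subalgebra.toSubmodule
        (Subalgebra.center (Subring.center D) (Matrix (Fin n) (Fin n) D)) ⊔
      Submodule.span (Subring.center D) (NCPoly.image f (Matrix (Fin n) (Fin n) D)) = ⊤ := by
  have : NeZero n := ⟨by omega⟩
  have : Algebra.IsCentral (Subring.center D) D :=
    ⟨fun x hx => Algebra.mem_bot.2 ⟨⟨x, hx⟩, rfl⟩⟩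
  exact NCPoly.center_sup_span_image_eq_top (hD.traceFunctionalsDetectedByOne hn)
    hD.two_ne_zero_or_odd_finrank f fun hsub => hf_central ⟨hsub, hf_id⟩
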